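/- Let $r,p\ge 1$, let $f\in\mathbb{R}^{r\times p}$, let $Q\in\mathbb{R}^{r\times r}$ and $S\in\mathbb{R}^{p\times p}$ be symmetric positive definite, let $N=\mathrm{diag}(n_1,\dots,n_p)$ with all $n_i>0$, and let $v\in\mathbb{R}$ be such that the density (1) below has finite total mass, that is, $2v+\mathrm{tr}(N)/p>2p$. Write $|\cdot|$ for the determinant and $\mathrm{etr}(\cdot)=\exp(\mathrm{tr}(\cdot))$. A random $p\times p$ matrix $\Sigma$ follows the modified inverted Wishart distribution $MIW_p(S,N,v)$ if it is almost surely symmetric positive definite and has, with respect to $d\Sigma=\prod_{i\le j}d\sigma_{ij}$ on the cone of positive definite matrices, a density proportional to $$|\Sigma|^{-\{v+\mathrm{tr}(N)/(2p)\}}\,\mathrm{etr}\left(-\tfrac12 N^{1/2}SN^{1/2}\Sigma^{-1}\right).\qquad(1)$$ For a positive definite $\Sigma$, the matrix normal distribution $N_{r\times p}(f,Q,\Sigma)$ is the law of an $r\times p$ random matrix $Y$ whose column-stacked vector $\mathrm{vec}(Y)$ is Gaussian with mean $\mathrm{vec}(f)$ and covariance matrix $\Sigma\otimes Q$. There is a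 constant $c>0$, depending only on $r,p,f,Q,S,N,v$, such that the following holds. If $\Sigma\sim MIW_p(S,N,v)$ and the conditional distribution of the $r\times p$ random matrix $Y$ given $\Sigma$ is $N_{r\times p}(f,Q,\Sigma)$, then the marginal distribution of $Y$ is absolutely continuous with respect to Lebesgue measure on $\mathbb{R}^{r\times p}$, with density $$p(Y)=c\,\left|N^{1/2}SN^{1/2}+(Y-f)'Q^{-1}(Y-f)\right|^{-\{2v+\mathrm{tr}(N)/p+r-p-1\}/2}.$$ (This distribution is called the modified matrix $t$ distribution $MT(f,Q,S,N,v)$.) -/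

import Mathlib

open MeasureTheory ProbabilityTheory

/-- Real matrices carry the product σ-algebra of their entries. -/
instance Matrix.instMeasurableSpaceReal {m n : Type*} : MeasurableSpace (Matrix m n ℝ) :=
  inferInstanceAs (MeasurableSpace (m → n → ℝ))

/-- The product σ-algebra on finite real matrices is standard Borel. -/
instance Matrix.instStandardBorelSpaceReal {m n : Type*} [Fintype m] [Fintype n] :
    StandardBorelSpace (Matrix m n ℝ) :=
  inferInstanceAs (StandardBorelSpace (m → n → ℝ))

namespace ModifiedWishart

/-- Lebesgue measure `∏ᵢⱼ dyᵢⱼ` on the space of `r × p` real matrices. -/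
noncomputable def matrixLebesgue (r p : ℕ) : Measure (Matrix (Fin r) (Fin p) ℝ) :=
  (volume : Measure (Fin r → Fin p → ℝ)).map Matrix.of

/-- The positions on and above the diagonal of a `p × p` matrix. -/
abbrev UpperIdx (p : ℕ) : Type := {ij : Fin p × Fin p // ij.1 ≤ ij.2}

/-- The symmetric matrix with prescribed entries on and above the diagonal. -/
def symMatrix {p : ℕ} (x : UpperIdx p → ℝ) : Matrix (Fin p) (Fin p) ℝ :=
  Matrix.of fun i j => x ⟨(min i j, max i j), min_le_max⟩

/-- The measure `dΣ = ∏_{i ≤ j} dσᵢⱼ`, carried by the symmetric `p × p` matrices. -/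
noncomputable def symLebesgue (p : ℕ) : Measure (Matrix (Fin p) (Fin p) ℝ) :=
  (volume : Measure (UpperIdx p → ℝ)).map symMatrix

/-- The matrix `N^{1/2} S N^{1/2}`, where `N = diag(n₁, …, n_p)`. -/
noncomputable def scaleMatrix {p : ℕ} (S : Matrix (Fin p) (Fin p) ℝ) (n : Fin p → ℝ) :
    Matrix (Fin p) (Fin p) ℝ :=
  Matrix.diagonal (fun i => √(n i)) * S * Matrix.diagonal (fun i => √(n i))

/-- The unnormalized density
`|Σ|^{-{v + tr(N)/(2p)}} etr(-½ N^{1/2} S N^{1/2} Σ⁻¹)`, where `N = diag(n₁, …, n_p)`. -/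
noncomputable def miwWeight {p : ℕ} (S : Matrix (Fin p) (Fin p) ℝ) (n : Fin p → ℝ) (v : ℝ)
    (σ : Matrix (Fin p) (Fin p) ℝ) : ℝ :=
  σ.det ^ (-(v + (Matrix.diagonal n).trace / (2 * (p : ℝ)))) *
    Real.exp ((-(1 / 2 : ℝ) • (scaleMatrix S n * σ⁻¹)).trace)

/-- The measure with density `miwWeight S n v` on the cone of positive definite matrices. -/
noncomputable def miwUnnormalized {p : ℕ} (S : Matrix (Fin p) (Fin p) ℝ) (n : Fin p → ℝ)
    (v : ℝ) : Measure (Matrix (Fin p) (Fin p) ℝ) :=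
  ((symLebesgue p).restrict {σ | σ.PosDef}).withDensity
    fun σ => ENNReal.ofReal (miwWeight S n v σ)

/-- The modified inverted Wishart distribution `MIW_p(S, N, v)` with `N = diag(n₁, …, n_p)`:
the density `miwWeight S n v` on the positive definite cone, divided by its total mass.
If the total mass is infinite this is the zero measure, which is the law of no random matrix. -/
noncomputable def modifiedInvertedWishart {p : ℕ} (S : Matrix (Fin p) (Fin p) ℝ)
    (n : Fin p → ℝ) (v : ℝ) : Measure (Matrix (Fin p) (Fin p) ℝ) :=
  (miwUnnormalized S n v Set.univ)⁻¹ • miwUnnormalized S n v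

/-- The matrix normal distribution `N_{r×p}(f, Q, Σ)`: the law of the `r × p` random matrix `Y`
for which `vec Y` (columns stacked) is Gaussian with mean `vec f` and covariance `Σ ⊗ Q`. -/
noncomputable def matrixNormal {r p : ℕ} (f : Matrix (Fin r) (Fin p) ℝ)
    (Q : Matrix (Fin r) (Fin r) ℝ) (σ : Matrix (Fin p) (Fin p) ℝ) :
    Measure (Matrix (Fin r) (Fin p) ℝ) :=
  (multivariateGaussian (WithLp.toLp 2 f.vec) (Matrix.kronecker σ Q)).map
    fun x => Matrix.of fun i j => x (j, i)

end ModifiedWishart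

/-!
For fixed `y`, the matrix normal density at `y` is, as a function of `Σ`, again of the form
`|Σ|^{-b} etr(-½ B Σ⁻¹)`, with `b = r / 2` and `B = (y - f)ᵀ Q⁻¹ (y - f)`. Multiplying it by the
density of `Σ` adds exponents and scale matrices, so integrating `Σ` out leaves the integral of one
such function over the cone of positive definite matrices. The substitution `Σ ↦ L Σ Lᵀ` has
Jacobian `|L|^(p + 1)` on symmetric matrices; with `L` the square root of `B` it shows that the
integral with parameters `b`, `B` is `|B|^{(p + 1) / 2 - b}` times the integral with parameters
`b`, `1`. The remaining constant need not be computed: the total mass of a law is `1`, so the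
constant is neither `0` nor `∞`.
-/

namespace ModifiedWishart

open Matrix
open scoped ENNReal

section MultiplicativeFunctions

variable {ι K M : Type*} [Fintype ι] [DecidableEq ι] [Field K] [NeZero (2 : K)] [CommMonoid M]

/- Conjugating a transvection by the diagonal matrix with entry `2` in position `i` squares it; in a
commutative monoid the conjugation is invisible. -/
lemma monoidHom_transvection (χ : Matrix ι ι K →* M) {i j : ι} (hij : i ≠ j) (c : K) :
    χ (transvection i j c) = 1 := by
  let d : ι → K := Function.update 1 i 2
  have isUnit_d : IsUnit (χ (diagonal d)) := by
    refine (isUnit_diagonal.2 (Pi.isUnit_iff.2 fun k => ?_)).map χ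
    rcases eq_or_ne k i with rfl | hk
    · simp [d, two_ne_zero]
    · simp [d, hk]
  have isUnit_transvection : IsUnit (χ (transvection i j c)) := by
    refine IsUnit.of_mul_eq_one (χ (transvection i j (-c))) ?_
    rw [← map_mul, transvection_mul_transvection_same _ _ hij, add_neg_cancel, transvection_zero,
      map_one]
  have conj_eq_sq : diagonal d * transvection i j c =
      transvection i j c * transvection i j c * diagonal d := by
    rw [transvection_mul_transvection_same _ _ hij]
    ext a b
    simp only [diagonal_mul, mul_diagonal, transvection, Matrix.add_apply, one_apply, single_apply,
      d, Function.update_apply, Pi.one_apply]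
    grind
  have map_conj : χ (transvection i j c) * χ (diagonal d) =
      χ (transvection i j c) * χ (transvection i j c) * χ (diagonal d) := by
    rw [mul_comm, ← map_mul, conj_eq_sq, map_mul, map_mul]
  exact (isUnit_transvection.mul_eq_left.1 (isUnit_d.mul_right_cancel map_conj).symm)

lemma monoidHom_ext_diagonal {χ ψ : Matrix ι ι K →* M}
    (h : ∀ d : ι → K, χ (diagonal d) = ψ (diagonal d)) : χ = ψ := by
  refine MonoidHom.ext fun A =>
    diagonal_transvection_induction (fun A => χ A = ψ A) A (fun d _ => h d) (fun t => ?_) ?_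
  · rw [TransvectionStruct.toMatrix, monoidHom_transvection χ t.hij,
      monoidHom_transvection ψ t.hij]
  · intro A B hA hB
    rw [map_mul, map_mul, hA, hB]

end MultiplicativeFunctions

section Congruence

variable {p : ℕ}

lemma symMatrix_apply_of_le (x : UpperIdx p → ℝ) {i j : Fin p} (h : i ≤ j) :
    symMatrix x i j = x ⟨(i, j), h⟩ := by
  simp [symMatrix, min_eq_left h, max_eq_right h]

lemma transpose_symMatrix (x : UpperIdx p → ℝ) : (symMatrix x)ᵀ = symMatrix x := by
  ext i j
  simp [symMatrix, min_comm, max_comm]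

lemma symMatrix_upperEntries {A : Matrix (Fin p) (Fin p) ℝ} (hA : A.IsSymm) :
    symMatrix (fun ij : UpperIdx p => A ij.1.1 ij.1.2) = A := by
  ext i j
  rcases le_total i j with h | h
  · rw [symMatrix_apply_of_le _ h]
  · rw [← transpose_symMatrix, transpose_apply, symMatrix_apply_of_le _ h, hA.apply]

/-- The congruence `X ↦ L X Lᵀ` on symmetric matrices, written in the coordinates on and above the
diagonal so that its determinant is the Jacobian with respect to `symLebesgue`. -/
def symCongr (L : Matrix (Fin p) (Fin p) ℝ) : Module.End ℝ (UpperIdx p → ℝ) where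
  toFun x := fun ij => (L * symMatrix x * Lᵀ) ij.1.1 ij.1.2
  map_add' x y := by
    have symMatrix_add : symMatrix (x + y) = symMatrix x + symMatrix y := rfl
    ext ij
    simp [symMatrix_add, Matrix.mul_add, Matrix.add_mul]
  map_smul' c x := by
    have symMatrix_smul : symMatrix (c • x) = c • symMatrix x := rfl
    ext ij
    simp [symMatrix_smul]

lemma symCongr_apply (L : Matrix (Fin p) (Fin p) ℝ) (x : UpperIdx p → ℝ) (ij : UpperIdx p) :
    symCongr L x ij = (L * symMatrix x * Lᵀ) ij.1.1 ij.1.2 :=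
  rfl

lemma symMatrix_symCongr (L : Matrix (Fin p) (Fin p) ℝ) (x : UpperIdx p → ℝ) :
    symMatrix (symCongr L x) = L * symMatrix x * Lᵀ :=
  symMatrix_upperEntries (A := L * symMatrix x * Lᵀ) <| by
    simp [IsSymm, transpose_mul, transpose_symMatrix, Matrix.mul_assoc]

/-- The action of matrices on symmetric matrices by congruence, as a homomorphism; composed with
`LinearMap.det` it is a multiplicative function of the acting matrix. -/
def symCongrHom (p : ℕ) : Matrix (Fin p) (Fin p) ℝ →* Module.End ℝ (UpperIdx p → ℝ) where
  toFun := symCongr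
  map_one' := by
    refine LinearMap.ext fun x => funext fun ij => ?_
    rw [symCongr_apply, transpose_one, Matrix.one_mul, Matrix.mul_one,
      symMatrix_apply_of_le _ ij.2, Module.End.one_apply]
  map_mul' A B := by
    refine LinearMap.ext fun x => funext fun ij => ?_
    rw [Module.End.mul_apply, symCongr_apply, symCongr_apply, symMatrix_symCongr, transpose_mul]
    simp only [Matrix.mul_assoc]

lemma prod_upperIdx_mul {M : Type*} [CommMonoid M] (d : Fin p → M) :
    ∏ ij : UpperIdx p, d ij.1.1 * d ij.1.2 = (∏ i, d i) ^ (p + 1) := by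
  have prod_eq_iterated (F : Fin p → Fin p → M) :
      ∏ ij : UpperIdx p, F ij.1.1 ij.1.2 = ∏ i, ∏ j, if i ≤ j then F i j else 1 := by
    rw [← Fintype.prod_prod_type' (fun i j => if i ≤ j then F i j else 1), ← Finset.prod_filter]
    exact (Finset.prod_subtype (Finset.univ.filter fun ij : Fin p × Fin p => ij.1 ≤ ij.2) (by simp)
      fun ij => F ij.1 ij.2).symm
  have prod_fst : ∏ ij : UpperIdx p, d ij.1.1 = ∏ i, d i ^ (p - i) := by
    rw [prod_eq_iterated fun i _ => d i]
    refine Finset.prod_congr rfl fun i _ => ?_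
    rw [← Finset.prod_filter, Finset.filter_le_eq_Ici, Finset.prod_const, Fin.card_Ici]
  have prod_snd : ∏ ij : UpperIdx p, d ij.1.2 = ∏ j, d j ^ (j + 1 : ℕ) := by
    rw [prod_eq_iterated fun _ j => d j, Finset.prod_comm]
    refine Finset.prod_congr rfl fun j _ => ?_
    rw [← Finset.prod_filter, Finset.filter_ge_eq_Iic, Finset.prod_const, Fin.card_Iic]
  rw [Finset.prod_mul_distrib, prod_fst, prod_snd, ← Finset.prod_mul_distrib, ← Finset.prod_pow]
  refine Finset.prod_congr rfl fun i _ => ?_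
  rw [← pow_add]
  congr 1
  omega

lemma det_symCongr_diagonal (d : Fin p → ℝ) :
    LinearMap.det (symCongr (diagonal d)) = (∏ i, d i) ^ (p + 1) := by
  have symCongr_eq : symCongr (diagonal d) =
      toLin' (diagonal fun ij : UpperIdx p => d ij.1.1 * d ij.1.2) := by
    refine LinearMap.ext fun x => funext fun ij => ?_
    rw [symCongr_apply, diagonal_transpose, mul_diagonal, diagonal_mul,
      symMatrix_apply_of_le _ ij.2, toLin'_apply, mulVec_diagonal]
    ring
  rw [symCongr_eq, LinearMap.det_toLin', det_diagonal, prod_upperIdx_mul]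

lemma det_symCongr (L : Matrix (Fin p) (Fin p) ℝ) :
    LinearMap.det (symCongr L) = L.det ^ (p + 1) := by
  have hom_eq : LinearMap.det.comp (symCongrHom p) =
      (powMonoidHom (p + 1)).comp (detMonoidHom : Matrix (Fin p) (Fin p) ℝ →* ℝ) :=
    monoidHom_ext_diagonal fun d => by
      simpa [symCongrHom, Finset.prod_pow] using det_symCongr_diagonal d
  exact DFunLike.congr_fun hom_eq L

end Congruence

section Measurability

instance borelSpace_matrix {m n : Type*} [Finite m] [Finite n] : BorelSpace (Matrix m n ℝ) := by
  cases nonempty_fintype m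
  cases nonempty_fintype n
  exact inferInstanceAs (BorelSpace (m → n → ℝ))

instance secondCountableTopology_matrix {m n : Type*} [Countable m] [Countable n] :
    SecondCountableTopology (Matrix m n ℝ) :=
  inferInstanceAs (SecondCountableTopology (m → n → ℝ))

lemma measurable_symMatrix {p : ℕ} : Measurable (symMatrix : (UpperIdx p → ℝ) → _) :=
  measurable_pi_lambda _ fun _ => measurable_pi_lambda _ fun _ => measurable_pi_apply _

lemma measurable_matrix_inv {ι : Type*} [Fintype ι] [DecidableEq ι] :
    Measurable fun A : Matrix ι ι ℝ => A⁻¹ := by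
  simp only [Matrix.inv_def, Ring.inverse_eq_inv']
  exact continuous_id.matrix_det.measurable.inv.smul continuous_id.matrix_adjugate.measurable

lemma isClosed_posSemidef {ι : Type*} [Finite ι] :
    IsClosed {A : Matrix ι ι ℝ | A.PosSemidef} := by
  cases nonempty_fintype ι
  simp only [posSemidef_iff_dotProduct_mulVec, Set.ofPred_and, Set.ofPred_forall]
  refine IsClosed.inter (isClosed_eq continuous_id.matrix_conjTranspose continuous_id) ?_
  exact isClosed_iInter fun x => isClosed_le continuous_const (by fun_prop)

lemma measurableSet_posDef {ι : Type*} [Finite ι] :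
    MeasurableSet {A : Matrix ι ι ℝ | A.PosDef} := by
  classical
  cases nonempty_fintype ι
  have posDef_iff (A : Matrix ι ι ℝ) : A.PosDef ↔ A.PosSemidef ∧ A.det ≠ 0 :=
    ⟨fun h => ⟨h.posSemidef, h.det_pos.ne'⟩, fun h => h.1.posDef_iff_det_ne_zero.2 h.2⟩
  simp only [posDef_iff, Set.ofPred_and]
  exact isClosed_posSemidef.measurableSet.inter
    (isOpen_ne_fun continuous_id.matrix_det continuous_const).measurableSet

end Measurability

section SquareRoots

variable {ι : Type*} [Fintype ι] [DecidableEq ι]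

lemma posDef_congr_iff {L : Matrix ι ι ℝ} (hL : L.det ≠ 0) {A : Matrix ι ι ℝ} :
    (L * A * Lᵀ).PosDef ↔ A.PosDef := by
  have isUnit_L : IsUnit L := (isUnit_iff_isUnit_det L).2 (isUnit_iff_ne_zero.2 hL)
  simpa only [star_eq_conjTranspose, conjTranspose_eq_transpose_of_trivial] using
    isUnit_L.posDef_star_right_conjugate_iff (x := A)

open scoped MatrixOrder

lemma transpose_sqrt (A : Matrix ι ι ℝ) : (CFC.sqrt A)ᵀ = CFC.sqrt A := by
  simpa only [star_eq_conjTranspose, conjTranspose_eq_transpose_of_trivial] using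
    (CFC.sqrt_nonneg A).isSelfAdjoint.star_eq

lemma sqrt_mul_transpose_sqrt {A : Matrix ι ι ℝ} (hA : A.PosSemidef) :
    CFC.sqrt A * (CFC.sqrt A)ᵀ = A := by
  rw [transpose_sqrt, CFC.sqrt_mul_sqrt_self _ hA.nonneg]

lemma det_sqrt_pos {A : Matrix ι ι ℝ} (hA : A.PosDef) : 0 < (CFC.sqrt A).det := by
  simpa [hA.posSemidef.det_sqrt] using hA.det_pos

end SquareRoots

section ConeIntegral

variable {p : ℕ}

lemma smul_map_symLebesgue_congr {L : Matrix (Fin p) (Fin p) ℝ} (hL : L.det ≠ 0) :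
    ENNReal.ofReal (|L.det| ^ (p + 1)) • (symLebesgue p).map (fun σ => L * σ * Lᵀ) =
      symLebesgue p := by
  have pow_pos : 0 < |L.det| ^ (p + 1) := pow_pos (abs_pos.2 hL) _
  have det_ne_zero : LinearMap.det (symCongr L) ≠ 0 := by
    rw [det_symCongr]
    exact pow_ne_zero _ hL
  have measurable_congr : Measurable fun σ : Matrix (Fin p) (Fin p) ℝ => L * σ * Lᵀ :=
    Continuous.measurable (by fun_prop)
  have comp_symMatrix : (fun σ => L * σ * Lᵀ) ∘ symMatrix = symMatrix ∘ symCongr L :=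
    funext fun x => (symMatrix_symCongr L x).symm
  rw [symLebesgue, Measure.map_map measurable_congr measurable_symMatrix, comp_symMatrix,
    ← Measure.map_map measurable_symMatrix
      (LinearMap.continuous_of_finiteDimensional _).measurable,
    Measure.map_linearMap_addHaar_eq_smul_addHaar _ det_ne_zero, Measure.map_smul, smul_smul,
    ← ENNReal.ofReal_mul pow_pos.le, det_symCongr, abs_inv, abs_pow, mul_inv_cancel₀ pow_pos.ne',
    ENNReal.ofReal_one, one_smul]

/-- The function `|σ|^{-b} etr(-½ B σ⁻¹)` of `σ`: the unnormalized inverted Wishart density, and, up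
to a constant, the matrix normal density as a function of the covariance. -/
noncomputable def invWishartWeight (b : ℝ) (B σ : Matrix (Fin p) (Fin p) ℝ) : ℝ :=
  σ.det ^ (-b) * Real.exp (-(1 / 2) * (B * σ⁻¹).trace)

lemma invWishartWeight_nonneg (b : ℝ) (B : Matrix (Fin p) (Fin p) ℝ)
    {σ : Matrix (Fin p) (Fin p) ℝ} (hσ : σ.PosDef) : 0 ≤ invWishartWeight b B σ :=
  mul_nonneg (Real.rpow_nonneg hσ.det_pos.le _) (Real.exp_nonneg _)

lemma measurable_invWishartWeight (b : ℝ) :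
    Measurable fun z : Matrix (Fin p) (Fin p) ℝ × Matrix (Fin p) (Fin p) ℝ =>
      invWishartWeight b z.1 z.2 := by
  have measurable_det : Measurable fun z : Matrix (Fin p) (Fin p) ℝ × Matrix (Fin p) (Fin p) ℝ =>
      z.2.det := continuous_snd.matrix_det.measurable
  have measurable_trace : Measurable fun z : Matrix (Fin p) (Fin p) ℝ × Matrix (Fin p) (Fin p) ℝ =>
      (z.1 * z.2⁻¹).trace :=
    (continuous_fst.matrix_mul continuous_snd).matrix_trace.measurable.comp
      (measurable_fst.prodMk (measurable_matrix_inv.comp measurable_snd))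
  exact (measurable_det.pow_const _).mul (measurable_trace.const_mul _).exp

lemma measurable_ofReal_invWishartWeight (b : ℝ) (B : Matrix (Fin p) (Fin p) ℝ) :
    Measurable fun σ => ENNReal.ofReal (invWishartWeight b B σ) :=
  ((measurable_invWishartWeight b).comp measurable_prodMk_left).ennreal_ofReal

lemma invWishartWeight_mul (b c : ℝ) (B C : Matrix (Fin p) (Fin p) ℝ)
    {σ : Matrix (Fin p) (Fin p) ℝ} (hσ : σ.PosDef) :
    invWishartWeight b B σ * invWishartWeight c C σ = invWishartWeight (b + c) (B + C) σ := by
  rw [invWishartWeight, invWishartWeight, invWishartWeight, neg_add, Real.rpow_add hσ.det_pos,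
    Matrix.add_mul, trace_add, mul_add, Real.exp_add]
  ring

lemma invWishartWeight_congr (b : ℝ) (B : Matrix (Fin p) (Fin p) ℝ)
    {L σ : Matrix (Fin p) (Fin p) ℝ} (hL : L.det ≠ 0) (hσ : σ.PosDef) :
    invWishartWeight b (L * B * Lᵀ) (L * σ * Lᵀ) =
      (L.det ^ 2) ^ (-b) * invWishartWeight b B σ := by
  have isUnit_det : IsUnit L.det := isUnit_iff_ne_zero.2 hL
  have det_congr : (L * σ * Lᵀ).det = L.det ^ 2 * σ.det := by
    rw [det_mul, det_mul, det_transpose]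
    ring
  have mul_inv_congr : L * B * Lᵀ * (L * σ * Lᵀ)⁻¹ = L * (B * σ⁻¹) * L⁻¹ := by
    rw [Matrix.mul_inv_rev, Matrix.mul_inv_rev, Matrix.mul_assoc (L * B),
      mul_nonsing_inv_cancel_left _ _ (isUnit_det_transpose L isUnit_det)]
    simp only [Matrix.mul_assoc]
  have trace_congr : (L * B * Lᵀ * (L * σ * Lᵀ)⁻¹).trace = (B * σ⁻¹).trace := by
    rw [mul_inv_congr, trace_mul_comm, nonsing_inv_mul_cancel_left _ _ isUnit_det]
  rw [invWishartWeight, invWishartWeight, det_congr, trace_congr,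
    Real.mul_rpow (sq_nonneg _) hσ.det_pos.le, mul_assoc]

/-- The integral of `|σ|^{-b} etr(-½ B σ⁻¹)` over the cone of positive definite matrices, possibly
infinite; it normalizes the inverted Wishart density. -/
noncomputable def invWishartMass (b : ℝ) (B : Matrix (Fin p) (Fin p) ℝ) : ℝ≥0∞ :=
  ∫⁻ σ in {σ | σ.PosDef}, ENNReal.ofReal (invWishartWeight b B σ) ∂symLebesgue p

lemma invWishartMass_congr (b : ℝ) (B : Matrix (Fin p) (Fin p) ℝ)
    {L : Matrix (Fin p) (Fin p) ℝ} (hL : L.det ≠ 0) :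
    invWishartMass b (L * B * Lᵀ) =
      ENNReal.ofReal (|L.det| ^ (p + 1) * (L.det ^ 2) ^ (-b)) * invWishartMass b B := by
  have measurable_congr : Measurable fun σ : Matrix (Fin p) (Fin p) ℝ => L * σ * Lᵀ :=
    Continuous.measurable (by fun_prop)
  have preimage_posDef : (fun σ => L * σ * Lᵀ) ⁻¹' {σ | σ.PosDef} =
      {σ : Matrix (Fin p) (Fin p) ℝ | σ.PosDef} := Set.ext fun _ => posDef_congr_iff hL
  have weight_congr : ∀ σ ∈ {σ : Matrix (Fin p) (Fin p) ℝ | σ.PosDef},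
      ENNReal.ofReal (invWishartWeight b (L * B * Lᵀ) (L * σ * Lᵀ)) =
        ENNReal.ofReal ((L.det ^ 2) ^ (-b)) * ENNReal.ofReal (invWishartWeight b B σ) :=
    fun σ hσ => by rw [invWishartWeight_congr b B hL hσ, ENNReal.ofReal_mul (by positivity)]
  rw [invWishartMass, ← smul_map_symLebesgue_congr hL, Measure.restrict_smul,
    lintegral_smul_measure, smul_eq_mul,
    setLIntegral_map measurableSet_posDef (measurable_ofReal_invWishartWeight b _)
      measurable_congr,
    preimage_posDef, setLIntegral_congr_fun measurableSet_posDef weight_congr,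
    lintegral_const_mul _ (measurable_ofReal_invWishartWeight b B),
    ENNReal.ofReal_mul (by positivity), mul_assoc, invWishartMass]

open scoped MatrixOrder in
lemma invWishartMass_eq (b : ℝ) {B : Matrix (Fin p) (Fin p) ℝ} (hB : B.PosDef) :
    invWishartMass b B =
      ENNReal.ofReal (B.det ^ ((p + 1) / 2 - b)) *
        invWishartMass b (1 : Matrix (Fin p) (Fin p) ℝ) := by
  have det_pos : 0 < (CFC.sqrt B).det := det_sqrt_pos hB
  have sqrt_mul : CFC.sqrt B * 1 * (CFC.sqrt B)ᵀ = B := by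
    rw [Matrix.mul_one, sqrt_mul_transpose_sqrt hB.posSemidef]
  have sq_det : (CFC.sqrt B).det ^ 2 = B.det := by
    rw [sq, ← det_mul, CFC.sqrt_mul_sqrt_self _ hB.posSemidef.nonneg]
  have pow_det : |(CFC.sqrt B).det| ^ (p + 1) = B.det ^ (((p : ℝ) + 1) / 2) := by
    rw [abs_of_pos det_pos, ← sq_det, ← Real.rpow_natCast _ 2, ← Real.rpow_mul det_pos.le,
      ← Real.rpow_natCast]
    congr 1
    push_cast
    ring
  have mass_congr := invWishartMass_congr b 1 det_pos.ne'
  rwa [sqrt_mul, pow_det, sq_det, ← Real.rpow_add hB.det_pos, ← sub_eq_add_neg] at mass_congr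

end ConeIntegral

section Densities

lemma map_withDensity_comp {α β : Type*} [MeasurableSpace α] [MeasurableSpace β] {μ : Measure α}
    {T : α → β} (hT : Measurable T) {g : β → ℝ≥0∞} (hg : Measurable g) :
    (μ.withDensity (g ∘ T)).map T = (μ.map T).withDensity g := by
  ext s hs
  rw [Measure.map_apply hT hs, withDensity_apply _ (hT hs), withDensity_apply _ hs,
    setLIntegral_map hs hg hT]
  rfl

lemma lintegral_pi_prod {ι : Type*} [Fintype ι] {α : ι → Type*} [∀ i, MeasurableSpace (α i)]
    (μ : ∀ i, Measure (α i)) [∀ i, SigmaFinite (μ i)] {f : ∀ i, α i → ℝ≥0∞}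
    (hf : ∀ i, Measurable (f i)) :
    ∫⁻ x, ∏ i, f i (x i) ∂Measure.pi μ = ∏ i, ∫⁻ x, f i x ∂μ i := by
  classical
  have measurable_prod (s : Finset ι) : Measurable fun x : ∀ i, α i => ∏ i ∈ s, f i (x i) :=
    Finset.measurable_prod s fun i _ => (hf i).comp (measurable_pi_apply i)
  have lmarginal_prod (s : Finset ι) (x : ∀ i, α i) :
      (∫⋯∫⁻_s, (fun x => ∏ i ∈ s, f i (x i)) ∂μ) x = ∏ i ∈ s, ∫⁻ x, f i x ∂μ i := by
    induction s using Finset.induction_on with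
    | empty => simp
    | insert i s hi ih =>
      have prod_update (x : ∀ i, α i) (t : α i) :
          ∏ j ∈ insert i s, f j (Function.update x i t j) = f i t * ∏ j ∈ s, f j (x j) := by
        rw [Finset.prod_insert hi, Function.update_self]
        congr 1
        refine Finset.prod_congr rfl fun j hj => ?_
        rw [Function.update_of_ne (ne_of_mem_of_not_mem hj hi)]
      simp only [lmarginal_insert' _ (measurable_prod _) hi, prod_update,
        lintegral_mul_const _ (hf i)]
      rw [Finset.prod_insert hi, ← ih]
      exact lintegral_const_mul _ ((measurable_prod s).comp measurable_updateFinset)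
  obtain h | h := isEmpty_or_nonempty (∀ i, α i)
  · obtain ⟨i, hi⟩ := isEmpty_pi.1 h
    rw [lintegral_of_isEmpty,
      Finset.prod_eq_zero (Finset.mem_univ i) (lintegral_of_isEmpty (μ i) (f i))]
  · rw [lintegral_eq_lmarginal_univ h.some, lmarginal_prod]

lemma pi_withDensity {ι : Type*} [Fintype ι] {α : ι → Type*} [∀ i, MeasurableSpace (α i)]
    (μ : ∀ i, Measure (α i)) [∀ i, SigmaFinite (μ i)] {f : ∀ i, α i → ℝ≥0∞}
    (hf : ∀ i, Measurable (f i)) [∀ i, SigmaFinite ((μ i).withDensity (f i))] :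
    Measure.pi (fun i => (μ i).withDensity (f i)) =
      (Measure.pi μ).withDensity fun x => ∏ i, f i (x i) := by
  refine Measure.pi_eq fun s hs => ?_
  rw [withDensity_apply _ (.univ_pi hs), Measure.restrict_pi_pi, lintegral_pi_prod _ hf]
  exact Finset.prod_congr rfl fun i _ => (withDensity_apply _ (hs i)).symm

variable {ι : Type*} [Fintype ι]

lemma prod_gaussianPDFReal (x : ι → ℝ) :
    ∏ i, gaussianPDFReal 0 1 (x i) =
      (√(2 * Real.pi))⁻¹ ^ Fintype.card ι * Real.exp (-(1 / 2) * (x ⬝ᵥ x)) := by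
  simp only [gaussianPDFReal, Finset.prod_mul_distrib, ← Real.exp_sum, dotProduct, Finset.mul_sum]
  simp [sq, div_eq_inv_mul]

lemma pi_gaussianReal_eq_withDensity :
    Measure.pi (fun _ : ι => gaussianReal 0 1) =
      volume.withDensity fun x => ENNReal.ofReal (∏ i, gaussianPDFReal 0 1 (x i)) := by
  have gaussian_eq : gaussianReal 0 1 = volume.withDensity (gaussianPDF 0 1) :=
    gaussianReal_of_var_ne_zero 0 one_ne_zero
  have : SigmaFinite (volume.withDensity (gaussianPDF 0 1)) := gaussian_eq ▸ inferInstance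
  simp only [gaussian_eq, ENNReal.ofReal_prod_of_nonneg fun _ _ => gaussianPDFReal_nonneg 0 1 _]
  exact pi_withDensity (fun _ : ι => volume) fun _ => measurable_gaussianPDF 0 1

variable [DecidableEq ι]

lemma map_affine_withDensity (m : ι → ℝ) {R : Matrix ι ι ℝ} (hR : R.det ≠ 0)
    {g : (ι → ℝ) → ℝ≥0∞} (hg : Measurable g) :
    (volume.withDensity g).map (fun x => m + R *ᵥ x) =
      volume.withDensity fun y => ENNReal.ofReal |R.det|⁻¹ * g (R⁻¹ *ᵥ (y - m)) := by
  have measurable_affine : Measurable fun x : ι → ℝ => m + R *ᵥ x :=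
    Continuous.measurable (by fun_prop)
  have measurable_comp_inv : Measurable fun y : ι → ℝ => g (R⁻¹ *ᵥ (y - m)) :=
    hg.comp (Continuous.measurable (by fun_prop))
  have map_volume : (volume : Measure (ι → ℝ)).map (fun x => m + R *ᵥ x) =
      ENNReal.ofReal |R.det|⁻¹ • volume := by
    have affine_eq_comp : (fun x : ι → ℝ => m + R *ᵥ x) = (fun y => m + y) ∘ toLin' R := by
      ext x
      simp
    rw [affine_eq_comp, ← Measure.map_map (measurable_const_add m)
      (LinearMap.continuous_of_finiteDimensional _).measurable,
      Real.map_matrix_volume_pi_eq_smul_volume_pi hR, Measure.map_smul,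
      (measurePreserving_add_left volume m).map_eq, abs_inv]
  have inv_comp_affine : (fun y => g (R⁻¹ *ᵥ (y - m))) ∘ (fun x => m + R *ᵥ x) = g := by
    ext x
    rw [Function.comp_apply, add_sub_cancel_left, mulVec_mulVec,
      nonsing_inv_mul _ (isUnit_iff_ne_zero.2 hR), one_mulVec]
  have map_eq := map_withDensity_comp (μ := volume) measurable_affine measurable_comp_inv
  rw [inv_comp_affine, map_volume, withDensity_smul_measure,
    ← withDensity_smul _ measurable_comp_inv] at map_eq
  exact map_eq

/-- The density of the Gaussian distribution on `ι → ℝ` with mean `m` and positive definite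
covariance matrix `M`. -/
noncomputable def multivariateGaussianPDFReal (m : ι → ℝ) (M : Matrix ι ι ℝ) (y : ι → ℝ) : ℝ :=
  (√(2 * Real.pi))⁻¹ ^ Fintype.card ι * (√M.det)⁻¹ *
    Real.exp (-(1 / 2) * ((y - m) ⬝ᵥ M⁻¹ *ᵥ (y - m)))

open scoped MatrixOrder in
lemma inv_sqrt_mulVec_dotProduct_self {M : Matrix ι ι ℝ} (hM : M.PosSemidef) (z : ι → ℝ) :
    ((CFC.sqrt M)⁻¹ *ᵥ z) ⬝ᵥ ((CFC.sqrt M)⁻¹ *ᵥ z) = z ⬝ᵥ M⁻¹ *ᵥ z := by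
  conv_rhs => rw [← CFC.sqrt_mul_sqrt_self M hM.nonneg, Matrix.mul_inv_rev, ← mulVec_mulVec,
    dotProduct_mulVec, ← mulVec_transpose, transpose_nonsing_inv, transpose_sqrt]

open scoped MatrixOrder in
lemma map_ofLp_multivariateGaussian (m : EuclideanSpace ℝ ι) {M : Matrix ι ι ℝ} (hM : M.PosDef) :
    (multivariateGaussian m M).map WithLp.ofLp =
      volume.withDensity fun y => ENNReal.ofReal (multivariateGaussianPDFReal m.ofLp M y) := by
  have ofLp_comp_affine : (WithLp.ofLp ∘ fun x : EuclideanSpace ℝ ι =>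
      m + toEuclideanCLM (𝕜 := ℝ) (CFC.sqrt M) x) ∘ WithLp.toLp 2 =
      fun x => m.ofLp + CFC.sqrt M *ᵥ x := by
    ext x
    simp
  have measurable_pdf : Measurable fun x : ι → ℝ =>
      ENNReal.ofReal (∏ i, gaussianPDFReal 0 1 (x i)) :=
    (Finset.measurable_prod _ fun i _ =>
      (measurable_gaussianPDFReal 0 1).comp (measurable_pi_apply i)).ennreal_ofReal
  have abs_det_sqrt : |(CFC.sqrt M).det| = √M.det := by
    rw [abs_of_pos (det_sqrt_pos hM)]
    simpa using hM.posSemidef.det_sqrt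
  rw [multivariateGaussian, ← map_pi_eq_stdGaussian, Measure.map_map (by fun_prop) (by fun_prop),
    Measure.map_map (by fun_prop) (by fun_prop), ofLp_comp_affine, pi_gaussianReal_eq_withDensity,
    map_affine_withDensity _ (det_sqrt_pos hM).ne' measurable_pdf]
  congr 1 with y
  rw [← ENNReal.ofReal_mul (by positivity), prod_gaussianPDFReal,
    inv_sqrt_mulVec_dotProduct_self hM.posSemidef, abs_det_sqrt, multivariateGaussianPDFReal,
    mul_left_comm, ← mul_assoc]

end Densities

section MatrixNormal

open scoped Kronecker

variable {r p : ℕ}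

lemma measurePreserving_vec :
    MeasurePreserving (vec : Matrix (Fin r) (Fin p) ℝ → _) (matrixLebesgue r p) volume := by
  have measurable_vec : Measurable (vec : Matrix (Fin r) (Fin p) ℝ → _) :=
    measurable_pi_lambda _ fun x => (measurable_pi_apply x.1).comp (measurable_pi_apply x.2)
  refine ⟨measurable_vec, (Measure.pi_eq fun s hs => ?_).symm⟩
  have measurable_of : Measurable (Matrix.of : (Fin r → Fin p → ℝ) → Matrix (Fin r) (Fin p) ℝ) :=
    measurable_id
  have preimage_box : (vec ∘ Matrix.of : (Fin r → Fin p → ℝ) → _) ⁻¹' Set.univ.pi s =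
      Set.univ.pi fun i => Set.univ.pi fun j => s (j, i) := by
    ext y
    simp only [Set.mem_preimage, Set.mem_pi, Set.mem_univ, true_implies, Prod.forall]
    exact forall_comm
  rw [matrixLebesgue, Measure.map_map measurable_vec measurable_of,
    Measure.map_apply (measurable_vec.comp measurable_of) (.univ_pi hs), preimage_box]
  simp only [volume_pi_pi]
  rw [Finset.prod_comm, ← Fintype.prod_prod_type' (fun j i => volume (s (j, i)))]

/-- The matrix `(y - f)ᵀ Q⁻¹ (y - f)` of weighted products of the columns of the residual `y - f`,
by which observing `y` increases the scale matrix. -/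
noncomputable def residualScatter (f : Matrix (Fin r) (Fin p) ℝ) (Q : Matrix (Fin r) (Fin r) ℝ)
    (y : Matrix (Fin r) (Fin p) ℝ) : Matrix (Fin p) (Fin p) ℝ :=
  (y - f)ᵀ * Q⁻¹ * (y - f)

lemma continuous_residualScatter (f : Matrix (Fin r) (Fin p) ℝ) (Q : Matrix (Fin r) (Fin r) ℝ) :
    Continuous (residualScatter f Q) := by
  unfold residualScatter
  fun_prop

lemma residualScatter_posSemidef (f : Matrix (Fin r) (Fin p) ℝ) {Q : Matrix (Fin r) (Fin r) ℝ}
    (hQ : Q.PosDef) (y : Matrix (Fin r) (Fin p) ℝ) : (residualScatter f Q y).PosSemidef := by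
  simpa only [residualScatter, conjTranspose_eq_transpose_of_trivial] using
    hQ.inv.posSemidef.conjTranspose_mul_mul_same (y - f)

/-- The factor of the density of `N_{r×p}(f, Q, σ)` that depends neither on `σ` nor on the
observation. -/
noncomputable def matrixNormalConst (p : ℕ) (Q : Matrix (Fin r) (Fin r) ℝ) : ℝ :=
  (√(2 * Real.pi))⁻¹ ^ (p * r) * (√(Q.det ^ p))⁻¹

lemma matrixNormalConst_nonneg (p : ℕ) (Q : Matrix (Fin r) (Fin r) ℝ) :
    0 ≤ matrixNormalConst p Q := by
  unfold matrixNormalConst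
  positivity

/-- The density of the matrix normal distribution `N_{r×p}(f, Q, σ)` at `y`, written as a multiple
of an inverted Wishart weight in `σ`. -/
noncomputable def matrixNormalPDF (f : Matrix (Fin r) (Fin p) ℝ) (Q : Matrix (Fin r) (Fin r) ℝ)
    (σ : Matrix (Fin p) (Fin p) ℝ) (y : Matrix (Fin r) (Fin p) ℝ) : ℝ :=
  matrixNormalConst p Q * invWishartWeight (r / 2) (residualScatter f Q y) σ

lemma measurable_matrixNormalPDF (f : Matrix (Fin r) (Fin p) ℝ) (Q : Matrix (Fin r) (Fin r) ℝ) :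
    Measurable fun z : Matrix (Fin p) (Fin p) ℝ × Matrix (Fin r) (Fin p) ℝ =>
      ENNReal.ofReal (matrixNormalPDF f Q z.1 z.2) :=
  (((measurable_invWishartWeight _).comp
    (((continuous_residualScatter f Q).measurable.comp measurable_snd).prodMk
      measurable_fst)).const_mul _).ennreal_ofReal

lemma multivariateGaussianPDFReal_kronecker (f : Matrix (Fin r) (Fin p) ℝ)
    (Q : Matrix (Fin r) (Fin r) ℝ) {σ : Matrix (Fin p) (Fin p) ℝ} (hσ : σ.PosDef)
    (y : Matrix (Fin r) (Fin p) ℝ) :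
    multivariateGaussianPDFReal f.vec (σ ⊗ₖ Q) y.vec = matrixNormalPDF f Q σ y := by
  have transpose_inv : (σ⁻¹)ᵀ = σ⁻¹ := by
    simpa only [conjTranspose_eq_transpose_of_trivial] using hσ.inv.isHermitian.eq
  have quadratic_form : (y.vec - f.vec) ⬝ᵥ (σ ⊗ₖ Q)⁻¹ *ᵥ (y.vec - f.vec) =
      (residualScatter f Q y * σ⁻¹).trace := by
    rw [← vec_sub, inv_kronecker, kronecker_mulVec_vec, vec_dotProduct_vec, transpose_inv,
      residualScatter]
    simp only [Matrix.mul_assoc]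
  have inv_sqrt_det : (√(σ ⊗ₖ Q).det)⁻¹ = σ.det ^ (-(r / 2 : ℝ)) * (√(Q.det ^ p))⁻¹ := by
    rw [det_kronecker, Fintype.card_fin, Fintype.card_fin,
      Real.sqrt_mul (pow_nonneg hσ.det_pos.le _), mul_inv, Real.sqrt_eq_rpow, ← Real.rpow_natCast,
      ← Real.rpow_mul hσ.det_pos.le, Real.rpow_neg hσ.det_pos.le, mul_one_div]
  rw [multivariateGaussianPDFReal, quadratic_form, inv_sqrt_det, matrixNormalPDF,
    matrixNormalConst, invWishartWeight, Fintype.card_prod, Fintype.card_fin, Fintype.card_fin]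
  ring

lemma matrixNormal_eq_withDensity (f : Matrix (Fin r) (Fin p) ℝ) {Q : Matrix (Fin r) (Fin r) ℝ}
    (hQ : Q.PosDef) {σ : Matrix (Fin p) (Fin p) ℝ} (hσ : σ.PosDef) :
    matrixNormal f Q σ =
      (matrixLebesgue r p).withDensity fun y => ENNReal.ofReal (matrixNormalPDF f Q σ y) := by
  let unvec : (Fin p × Fin r → ℝ) → Matrix (Fin r) (Fin p) ℝ :=
    fun x => Matrix.of fun i j => x (j, i)
  let g : (Fin p × Fin r → ℝ) → ℝ≥0∞ := fun x =>
    ENNReal.ofReal (multivariateGaussianPDFReal f.vec (σ ⊗ₖ Q) x)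
  have measurable_unvec : Measurable unvec :=
    measurable_pi_lambda _ fun _ => measurable_pi_lambda _ fun _ => measurable_pi_apply _
  have measurable_g : Measurable g := by
    refine (Continuous.measurable ?_).ennreal_ofReal
    unfold multivariateGaussianPDFReal
    fun_prop
  calc matrixNormal f Q σ
      = ((multivariateGaussian (WithLp.toLp 2 f.vec) (σ ⊗ₖ Q)).map WithLp.ofLp).map unvec := by
        rw [Measure.map_map measurable_unvec (by fun_prop)]
        rfl
    _ = (((matrixLebesgue r p).map vec).withDensity g).map unvec := by
        rw [map_ofLp_multivariateGaussian _ (hσ.kronecker hQ), measurePreserving_vec.map_eq]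
    _ = ((matrixLebesgue r p).withDensity (g ∘ vec)).map (unvec ∘ vec) := by
        rw [← map_withDensity_comp measurePreserving_vec.measurable measurable_g,
          Measure.map_map measurable_unvec measurePreserving_vec.measurable]
    _ = (matrixLebesgue r p).withDensity (g ∘ vec) := Measure.map_id
    _ = _ := by
        congr 1 with y
        simp only [Function.comp_apply, g, multivariateGaussianPDFReal_kronecker f Q hσ]

end MatrixNormal

section Mixture

lemma map_eq_withDensity_of_condDistrib {Ω α β : Type*} [MeasurableSpace Ω] [MeasurableSpace α]
    [MeasurableSpace β] [StandardBorelSpace β] [Nonempty β] {P : Measure Ω} [IsFiniteMeasure P]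
    {X : Ω → α} {Y : Ω → β} {ν : Measure β} [SFinite ν] {h : α → β → ℝ≥0∞}
    (hX : AEMeasurable X P) (hY : AEMeasurable Y P) (hh : Measurable (Function.uncurry h))
    (hcond : ∀ᵐ x ∂P.map X, condDistrib Y X P x = ν.withDensity (h x)) :
    P.map Y = ν.withDensity fun y => ∫⁻ x, h x y ∂P.map X := by
  ext s hs
  rw [← condDistrib_comp_map hX hY, Measure.bind_apply hs (Kernel.measurable _).aemeasurable,
    withDensity_apply _ hs,
    lintegral_lintegral_swap (f := fun y x => h x y) (hh.comp measurable_swap).aemeasurable]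
  refine lintegral_congr_ae (hcond.mono fun x hx => ?_)
  simp only [hx, withDensity_apply _ hs]

lemma ne_zero_and_ne_top_of_isProbabilityMeasure_withDensity {α : Type*} [MeasurableSpace α]
    {ν : Measure α} {C : ℝ≥0∞} {g : α → ℝ≥0∞} (hg : ∀ x, g x ≠ 0)
    (h : IsProbabilityMeasure (ν.withDensity fun x => C * g x)) : C ≠ 0 ∧ C ≠ ∞ := by
  constructor
  · rintro rfl
    simpa using h.measure_univ
  · rintro rfl
    have mass_eq_one := h.measure_univ
    simp only [ENNReal.top_mul (hg _), withDensity_const, Measure.smul_apply, smul_eq_mul]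
      at mass_eq_one
    rcases eq_or_ne (ν Set.univ) 0 with h0 | h0 <;> simp [h0] at mass_eq_one

variable {r p : ℕ}

instance sFinite_matrixLebesgue : SFinite (matrixLebesgue r p) := by
  unfold matrixLebesgue
  infer_instance

lemma scaleMatrix_posDef {S : Matrix (Fin p) (Fin p) ℝ} {n : Fin p → ℝ} (hS : S.PosDef)
    (hn : ∀ i, 0 < n i) : (scaleMatrix S n).PosDef := by
  have det_ne_zero : (diagonal fun i => √(n i)).det ≠ 0 := by
    rw [det_diagonal]
    exact Finset.prod_ne_zero_iff.2 fun i _ => (Real.sqrt_pos.2 (hn i)).ne'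
  simpa only [scaleMatrix, diagonal_transpose] using (posDef_congr_iff det_ne_zero).2 hS

/-- The exponent `v + tr(N) / (2p)` of `|Σ|⁻¹` in the density of `MIW_p(S, N, v)`. -/
noncomputable def miwExponent (n : Fin p → ℝ) (v : ℝ) : ℝ :=
  v + (diagonal n).trace / (2 * (p : ℝ))

lemma miwWeight_eq_invWishartWeight (S : Matrix (Fin p) (Fin p) ℝ) (n : Fin p → ℝ) (v : ℝ) :
    miwWeight S n v = invWishartWeight (miwExponent n v) (scaleMatrix S n) := by
  ext σ
  rw [miwWeight, trace_smul, smul_eq_mul, invWishartWeight, miwExponent]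

lemma ae_posDef_modifiedInvertedWishart (S : Matrix (Fin p) (Fin p) ℝ) (n : Fin p → ℝ) (v : ℝ) :
    ∀ᵐ σ ∂modifiedInvertedWishart S n v, σ.PosDef :=
  Measure.ae_smul_measure ((withDensity_absolutelyContinuous _ _).ae_le
    (ae_restrict_mem measurableSet_posDef)) _

lemma lintegral_invWishartWeight_miwUnnormalized (S : Matrix (Fin p) (Fin p) ℝ) (n : Fin p → ℝ)
    (v b : ℝ) (B : Matrix (Fin p) (Fin p) ℝ) :
    ∫⁻ σ, ENNReal.ofReal (invWishartWeight b B σ) ∂miwUnnormalized S n v =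
      invWishartMass (miwExponent n v + b) (scaleMatrix S n + B) := by
  rw [miwUnnormalized, miwWeight_eq_invWishartWeight, lintegral_withDensity_eq_lintegral_mul _
    (measurable_ofReal_invWishartWeight _ _) (measurable_ofReal_invWishartWeight b B)]
  refine setLIntegral_congr_fun measurableSet_posDef fun σ hσ => ?_
  rw [Pi.mul_apply, ← ENNReal.ofReal_mul (invWishartWeight_nonneg _ _ hσ),
    invWishartWeight_mul _ _ _ _ hσ]

/-- The normalizing constant of the modified matrix `t` distribution, which does not involve the
mean `f`. It is `0` when `MIW_p(S, N, v)` has infinite mass. -/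
noncomputable def matrixTConst (r : ℕ) {p : ℕ} (Q : Matrix (Fin r) (Fin r) ℝ)
    (S : Matrix (Fin p) (Fin p) ℝ) (n : Fin p → ℝ) (v : ℝ) : ℝ≥0∞ :=
  (miwUnnormalized S n v Set.univ)⁻¹ * ENNReal.ofReal (matrixNormalConst p Q) *
    invWishartMass (miwExponent n v + r / 2) (1 : Matrix (Fin p) (Fin p) ℝ)

variable (f : Matrix (Fin r) (Fin p) ℝ) {Q : Matrix (Fin r) (Fin r) ℝ}
  {S : Matrix (Fin p) (Fin p) ℝ} {n : Fin p → ℝ} (v : ℝ)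

lemma scaleMatrix_add_residualScatter_posDef (hQ : Q.PosDef) (hS : S.PosDef) (hn : ∀ i, 0 < n i)
    (y : Matrix (Fin r) (Fin p) ℝ) : (scaleMatrix S n + residualScatter f Q y).PosDef :=
  (scaleMatrix_posDef hS hn).add_posSemidef (residualScatter_posSemidef f hQ y)

lemma lintegral_matrixNormalPDF_modifiedInvertedWishart (hQ : Q.PosDef) (hS : S.PosDef)
    (hn : ∀ i, 0 < n i) (y : Matrix (Fin r) (Fin p) ℝ) :
    ∫⁻ σ, ENNReal.ofReal (matrixNormalPDF f Q σ y) ∂modifiedInvertedWishart S n v =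
      matrixTConst r Q S n v *
        ENNReal.ofReal ((scaleMatrix S n + residualScatter f Q y).det ^
          (-(2 * v + (diagonal n).trace / (p : ℝ) + r - p - 1) / 2)) := by
  have exponent_eq : ((p : ℝ) + 1) / 2 - (miwExponent n v + r / 2) =
      -(2 * v + (diagonal n).trace / (p : ℝ) + r - p - 1) / 2 := by
    rw [miwExponent]
    ring
  simp only [matrixNormalPDF, ENNReal.ofReal_mul (matrixNormalConst_nonneg p Q)]
  rw [modifiedInvertedWishart, lintegral_smul_measure,
    lintegral_const_mul _ (measurable_ofReal_invWishartWeight _ _),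
    lintegral_invWishartWeight_miwUnnormalized,
    invWishartMass_eq _ (scaleMatrix_add_residualScatter_posDef f hQ hS hn y), exponent_eq,
    matrixTConst, smul_eq_mul]
  ring

lemma map_eq_withDensity_matrixT {Ω : Type*} [MeasurableSpace Ω] {P : Measure Ω}
    [IsFiniteMeasure P] {Y : Ω → Matrix (Fin r) (Fin p) ℝ} {Sg : Ω → Matrix (Fin p) (Fin p) ℝ}
    (hQ : Q.PosDef) (hS : S.PosDef) (hn : ∀ i, 0 < n i) (hY : AEMeasurable Y P)
    (hSg : HasLaw Sg (modifiedInvertedWishart S n v) P)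
    (hYS : ∀ᵐ σ ∂P.map Sg, condDistrib Y Sg P σ = matrixNormal f Q σ) :
    P.map Y = (matrixLebesgue r p).withDensity fun y => matrixTConst r Q S n v *
      ENNReal.ofReal ((scaleMatrix S n + residualScatter f Q y).det ^
        (-(2 * v + (diagonal n).trace / (p : ℝ) + r - p - 1) / 2)) := by
  have posDef_Sg : ∀ᵐ σ ∂P.map Sg, σ.PosDef :=
    hSg.map_eq ▸ ae_posDef_modifiedInvertedWishart S n v
  have condDistrib_eq : ∀ᵐ σ ∂P.map Sg, condDistrib Y Sg P σ =
      (matrixLebesgue r p).withDensity fun y => ENNReal.ofReal (matrixNormalPDF f Q σ y) := by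
    filter_upwards [hYS, posDef_Sg] with σ hcond hσ
    rw [hcond, matrixNormal_eq_withDensity f hQ hσ]
  rw [map_eq_withDensity_of_condDistrib (h := fun σ y => ENNReal.ofReal (matrixNormalPDF f Q σ y))
    hSg.aemeasurable hY (measurable_matrixNormalPDF f Q) condDistrib_eq, hSg.map_eq]
  simp only [lintegral_matrixNormalPDF_modifiedInvertedWishart f v hQ hS hn]

end Mixture

end ModifiedWishart

theorem proposition2 {r p : ℕ} (f : Matrix (Fin r) (Fin p) ℝ) (Q : Matrix (Fin r) (Fin r) ℝ)
    (S : Matrix (Fin p) (Fin p) ℝ) (n : Fin p → ℝ) (v : ℝ)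
    (hQ : Q.PosDef) (hS : S.PosDef) (hn : ∀ i, 0 < n i) :
    ∃ c : ℝ, 0 < c ∧
      ∀ {Ω : Type*} [MeasurableSpace Ω] (P : Measure Ω) [IsProbabilityMeasure P]
        (Y : Ω → Matrix (Fin r) (Fin p) ℝ) (Sg : Ω → Matrix (Fin p) (Fin p) ℝ),
        AEMeasurable Y P →
        HasLaw Sg (ModifiedWishart.modifiedInvertedWishart S n v) P →
        (∀ᵐ σ ∂(P.map Sg), condDistrib Y Sg P σ = ModifiedWishart.matrixNormal f Q σ) →
        HasLaw Y
          ((ModifiedWishart.matrixLebesgue r p).withDensity fun y =>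
            ENNReal.ofReal
              (c * (ModifiedWishart.scaleMatrix S n + (y - f).transpose * Q⁻¹ * (y - f)).det ^
                (-(2 * v + (Matrix.diagonal n).trace / (p : ℝ) + r - p - 1) / 2))) P := by
  let C := ModifiedWishart.matrixTConst r Q S n v
  -- If `MIW_p(S, N, v)` has infinite mass, no `Sg` has that law and any positive constant will do.
  refine ⟨if C.toReal = 0 then 1 else C.toReal, ?_, fun P _ Y Sg hY hSg hYS => ⟨hY, ?_⟩⟩
  · split_ifs with hC
    · exact one_pos
    · exact ENNReal.toReal_nonneg.lt_of_ne' hC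
  have law_Y := ModifiedWishart.map_eq_withDensity_matrixT f v hQ hS hn hY hSg hYS
  have det_pow_ne_zero (y : Matrix (Fin r) (Fin p) ℝ) := (ENNReal.ofReal_pos.2 <|
    Real.rpow_pos_of_pos
      (ModifiedWishart.scaleMatrix_add_residualScatter_posDef f hQ hS hn y).det_pos
      (-(2 * v + (Matrix.diagonal n).trace / (p : ℝ) + r - p - 1) / 2)).ne'
  obtain ⟨hC_zero, hC_top⟩ :=
    ModifiedWishart.ne_zero_and_ne_top_of_isProbabilityMeasure_withDensity det_pow_ne_zero
      (law_Y ▸ Measure.isProbabilityMeasure_map hY)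
  rw [law_Y, if_neg (ENNReal.toReal_ne_zero.2 ⟨hC_zero, hC_top⟩)]
  congr 1 with y
  rw [ENNReal.ofReal_mul ENNReal.toReal_nonneg, ENNReal.ofReal_toReal hC_top,
    ModifiedWishart.residualScatter]
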